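/- Let $T>0$, let $\beta\neq 0$ be real, and let $L^2(S^1)$ be the space of real square-integrable functions on the circle of length $T$, with orthonormal basis $e_0=\sqrt{1/T}$, $e_m(\tau)=\sqrt{2/T}\cos\frac{2\pi m\tau}{T}$ for $m>0$ and $e_m(\tau)=\sqrt{2/T}\sin\frac{2\pi |m|\tau}{T}$ for $m<0$. The path-integral measure is $Dn=\prod_{m\in\mathbb Z}\frac{dc_m}{\sqrt{2\pi}}$ for $n=\sum_m c_m e_m$, and the functional delta of the inhomogeneous sector (the functions orthogonal to the constants) is $\tilde\delta[\psi]=\int D\tilde\rho\, e^{i\oint\tilde\rho\,\psi}=\prod_{m\ne0}\sqrt{2\pi}\,\delta(\psi_m)$, where $\tilde\rho$ runs over that sector and $\psi_m=\oint e_m\psi$. These expressions are understood as follows. For $N\ge 0$ and $\varepsilon>0$ put $$\tilde\delta_{N,\varepsilon}[\psi]=\int\prod_{0<|m|\le N}\frac{d\rho_m}{\sqrt{2\pi}}\;e^{i\oint\tilde\rho\,\psi-\frac{\varepsilon}{2}\oint\tilde\rho^2},\quad \tilde\rho=\sum_{0<|m|\le N}\rho_m e_m,\qquad J_N=\lim_{\varepsilon\to0^+}\int\prod_{|m|\le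 N}\frac{dc_m}{\sqrt{2\pi}}\;\tilde\delta_{N,\varepsilon}[\beta\dot n]\,f[n],\quad n=\sum_{|m|\le N}c_me_m .$$ For $m\neq0$ let $z_m=\int\frac{dc}{\sqrt{2\pi}}\,\sqrt{2\pi}\,\delta\big(c\,\beta\oint e_{-m}\dot e_m\big)$ be the factor contributed by the single mode $m$ (with the delta regularized in the same way). The path integral is $$\int_{L^2(S^1)}Dn\;\tilde\delta[\beta\dot n]\,f[n]:=\Big(\prod_{m\neq0}z_m\Big)_{\zeta}\cdot\lim_{N\to\infty}\frac{J_N}{\prod_{0<|m|\le N}z_m},$$ where the zeta-regularized product of positive numbers $a_m$ is $\big(\prod_m a_m\big)_\zeta=e^{Z'(0)}$ with $Z$ the meromorphic continuation of $Z(s)=\sum_m a_m^{\,s}$ (convergent for large $\mathrm{Re}\,s$), required to be regular at $0$. Let $f:L^2(S^1)\to\mathbb C$ be continuous and such that, for some integrable $g:\mathbb R\to\mathbb R$ and some $K\in\mathbb R$, $|f[c+v]|\le g(c)\,e^{K\oint v^2}$ for all $c\in\mathbb R$ and all $v\in L^2(S^1)$ with $\oint v=0$. **Theorem.** The function $c\mapsto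 f[c]$ (the value of $f$ at the constant function $c$) is integrable on $\mathbb R$, the path integral exists, its value is uniquely determined, and $$\int_{L^2(S^1)}Dn\;\tilde\delta[\beta\dot n]\,f[n]=\frac{|\beta|}{\sqrt T}\int_{\mathbb R}\frac{dc}{\sqrt{2\pi}}\,f[c].$$ Moreover $z_m=\big|\frac{T}{2\pi m\beta}\big|$ for $m\ne0$, their zeta-regularized product is $\big(\prod_{m\neq0}\big|\frac{T}{2\pi m\beta}\big|\big)_\zeta=\frac{|\beta|}{T}$, and, by the rescaling $c_0=c\sqrt T$, $$\frac{|\beta|}{T}\int_{\mathbb R}\frac{dc_0}{\sqrt{2\pi}}\,f[c_0e_0]=\frac{|\beta|}{\sqrt T}\int_{\mathbb R}\frac{dc}{\sqrt{2\pi}}\,f[c].$$ -/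

import Mathlib

open MeasureTheory Filter Topology

noncomputable section

namespace CircleDelta

/-- The space of real square-integrable functions on the circle of length `T`
(the measure `volume` on `AddCircle T` has total mass `T`). -/
abbrev L2 (T : ℝ) [Fact (0 < T)] : Type :=
  Lp ℝ 2 (volume : Measure (AddCircle T))

/-- The orthonormal real trigonometric basis: `√(2/T) sin(2π|m|τ/T)` for `m < 0`, `√(1/T)` for
`m = 0`, and `√(2/T) cos(2πmτ/T)` for `m > 0`
(`fourier n` is `τ ↦ exp(2πinτ/T)`; see `basis_coe_neg`, `basis_coe_pos`). -/
def basis (T : ℝ) (m : ℤ) : C(AddCircle T, ℝ) where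
  toFun x :=
    if m < 0 then √(2 / T) * (fourier |m| x).im
    else if m = 0 then √(1 / T)
    else √(2 / T) * (fourier m x).re
  continuous_toFun := by
    split_ifs <;> fun_prop

theorem fourier_coe_eq (T : ℝ) (m : ℤ) (τ : ℝ) :
    fourier m (τ : AddCircle T) = Complex.exp (((2 * Real.pi * m * τ / T : ℝ) : ℂ) * Complex.I) := by
  rw [fourier_coe_apply]
  congr 1
  push_cast
  ring

theorem basis_coe_neg (T : ℝ) {m : ℤ} (hm : m < 0) (τ : ℝ) :
    basis T m (τ : AddCircle T) = √(2 / T) * Real.sin (2 * Real.pi * |(m : ℝ)| * τ / T) := by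
  simp only [basis, ContinuousMap.coe_mk, if_pos hm]
  rw [fourier_coe_eq, Complex.exp_ofReal_mul_I_im]
  push_cast
  rfl

theorem basis_coe_pos (T : ℝ) {m : ℤ} (hm : 0 < m) (τ : ℝ) :
    basis T m (τ : AddCircle T) = √(2 / T) * Real.cos (2 * Real.pi * m * τ / T) := by
  simp only [basis, ContinuousMap.coe_mk, if_neg hm.not_gt, if_neg hm.ne']
  rw [fourier_coe_eq, Complex.exp_ofReal_mul_I_re]

/-- The function `∑ c_m e_m` with modes `m` in the finite set `S`. -/
def modeSum (T : ℝ) (S : Finset ℤ) (c : S → ℝ) : C(AddCircle T, ℝ) :=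
  ∑ m : S, c m • basis T m

/-- The derivative of a function on the circle. -/
def circleDeriv {T : ℝ} (n : AddCircle T → ℝ) (x : AddCircle T) : ℝ :=
  deriv (fun t : ℝ => n (x + (t : AddCircle T))) 0

/-- A continuous function on the circle as an element of `L²`. -/
def toL2 (T : ℝ) [Fact (0 < T)] (n : C(AddCircle T, ℝ)) : L2 T :=
  ContinuousMap.toLp (E := ℝ) 2 (volume : Measure (AddCircle T)) ℝ n

/-- The constant function `c` as an element of `L²`. -/
def constL2 (T : ℝ) [Fact (0 < T)] (c : ℝ) : L2 T :=
  toL2 T (ContinuousMap.const _ c)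

/-- The measure `dc/√(2π)` on the real line. -/
def lineMeasure : Measure ℝ :=
  ENNReal.ofReal (√(2 * Real.pi))⁻¹ • volume

/-- The measure `∏ dc_m/√(2π)`, `m ∈ S`, on the coefficients of finitely many modes. -/
def modeMeasure (S : Finset ℤ) : Measure (S → ℝ) :=
  ENNReal.ofReal (√(2 * Real.pi))⁻¹ ^ S.card • volume

/-- The functional delta over the finitely many modes in `R`, in its Fourier representation with a
Gaussian convergence factor: `∫ Dρ exp(i ∮ ρψ - (ε/2) ∮ ρ²)`, where `ρ` runs over the span of
the basis functions with modes in `R`. -/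
def modeDelta (T : ℝ) [Fact (0 < T)] (R : Finset ℤ) (ε : ℝ) (ψ : AddCircle T → ℝ) : ℂ :=
  ∫ ρ : R → ℝ,
    Complex.exp (Complex.I * ((∫ x : AddCircle T, modeSum T R ρ x * ψ x : ℝ) : ℂ)
      - ((ε / 2 * ∫ x : AddCircle T, (modeSum T R ρ x) ^ 2 : ℝ) : ℂ))
    ∂(modeMeasure R)

/-- The integrand `δ[β ṅ] f[n]` at `n = ∑ c_m e_m`, with `n` restricted to the modes in `S`
and the delta to the modes in `R`. -/
def modeIntegrand (T : ℝ) [Fact (0 < T)] (S R : Finset ℤ) (β : ℝ) (f : L2 T → ℂ) (ε : ℝ)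
    (c : S → ℝ) : ℂ :=
  modeDelta T R ε (fun x => β * circleDeriv (modeSum T S c) x) * f (toL2 T (modeSum T S c))

/-- `∫ Dn δ[β ṅ] f[n] = J`, with `n` restricted to the modes in `S` and the delta to the modes
in `R`: the value when the convergence factor in the delta is removed. -/
def HasModeIntegral (T : ℝ) [Fact (0 < T)] (S R : Finset ℤ) (β : ℝ) (f : L2 T → ℂ) (J : ℂ) :
    Prop :=
  (∀ᶠ ε in 𝓝[>] (0 : ℝ), Integrable (modeIntegrand T S R β f ε) (modeMeasure S)) ∧
  Tendsto (fun ε : ℝ => ∫ c : S → ℝ, modeIntegrand T S R β f ε c ∂(modeMeasure S))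
    (𝓝[>] 0) (𝓝 J)

/-- `P` is the zeta-regularized product of the positive numbers `a i`: the series `∑ (a i)^s`
converges in some half-plane, its sum continues to a meromorphic function `F` on `ℂ` that is
regular at `0`, and `P = exp (F' 0)`. -/
def HasZetaProd {ι : Type*} (a : ι → ℝ) (P : ℝ) : Prop :=
  (∀ i, 0 < a i) ∧
  ∃ (F : ℂ → ℂ) (σ : ℝ),
    (∀ s : ℂ, σ < s.re → HasSum (fun i => (a i : ℂ) ^ s) (F s)) ∧
    MeromorphicOn F Set.univ ∧ AnalyticAt ℂ F 0 ∧ (P : ℂ) = Complex.exp (deriv F 0)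

/-- The modes `-N, …, N`. -/
def cutoff (N : ℕ) : Finset ℤ := Finset.Icc (-(N : ℤ)) N

/-- The inhomogeneous modes among `-N, …, N`. -/
def inhCutoff (N : ℕ) : Finset ℤ := (cutoff N).erase 0

/-- `z` is the factor `∫ (dc/√(2π)) √(2π) δ(β ∮ e_{-m} d(c e_m)/dτ)` that the single mode `m`
contributes (the derivative of `e_m` is a multiple of `e_{-m}`). -/
def IsModeFactor (T : ℝ) [Fact (0 < T)] (β : ℝ) (m : ℤ) (z : ℝ) : Prop :=
  HasModeIntegral T {m} {-m} β (fun _ => 1) (z : ℂ)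

/-- The zeta-regularized path integral `∫ Dn δ̃[β ṅ] f[n]` over `L²` of the circle has the
value `I`. The integral is cut off to the modes `|m| ≤ N`, with the delta over the inhomogeneous
modes `0 < |m| ≤ N`; in the limit `N → ∞` the product of the factors of the inhomogeneous modes
is replaced by its zeta-regularized value. -/
def HasDeltaPathIntegral (T : ℝ) [Fact (0 < T)] (β : ℝ) (f : L2 T → ℂ) (I : ℂ) : Prop :=
  ∃ (z : ℤ → ℝ) (P : ℝ) (J : ℕ → ℂ) (L : ℂ),
    (∀ m : ℤ, m ≠ 0 → IsModeFactor T β m (z m)) ∧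
    HasZetaProd (fun m : {m : ℤ // m ≠ 0} => z m) P ∧
    (∀ N : ℕ, HasModeIntegral T (cutoff N) (inhCutoff N) β f (J N)) ∧
    Tendsto (fun N : ℕ => J N / ∏ m ∈ inhCutoff N, (z m : ℂ)) atTop (𝓝 L) ∧
    I = P * L

/-- Test functionals: continuous functionals on `L²` that are integrable along the constants, with
at most Gaussian growth in the inhomogeneous directions. Exponentials `exp(-q)` of continuous
quadratic polynomials `q` that are positive definite on the constants are of this kind. -/
def IsTestFunctional (T : ℝ) [Fact (0 < T)] (f : L2 T → ℂ) : Prop :=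
  Continuous f ∧
  ∃ (g : ℝ → ℝ) (K : ℝ), Integrable g ∧
    ∀ (c : ℝ) (v : L2 T), (∫ x : AddCircle T, v x) = 0 →
      ‖f (constL2 T c + v)‖ ≤ g c * Real.exp (K * ‖v‖ ^ 2)

end CircleDelta

end

open CircleDelta

namespace CircleDelta

/-! Differentiation sends `e_m` to `-(2πm/T) e_{-m}`, so the delta constrains each inhomogeneous
coefficient separately. Its Gaussian regularization over finitely many modes is a product of
one-dimensional Gaussians of width proportional to `√ε` (`modeDelta_circleDeriv`). Rescaling each
`c_m` by its width removes `ε` from the weight and moves it into the argument of `f`. Dominated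
convergence then freezes every inhomogeneous coefficient at 0, each one leaving the factor `|T /
(2πmβ)|` (`eventually_integrable_and_tendsto_integral_deltaProd_mul`, `hasModeIntegral_of_bound`).

Hence `J_N` is the product of the mode factors times the integral of `f` along `e_0`. The normalized
quotient does not depend on `N`, and its limit is immediate. The infinite product is governed by `2
C^s ζ(s)` with `C = T / (2π|β|)`, and the known values of `ζ` and `ζ'` at 0 give `|β| / T`
(`hasZetaProd_const_div_natAbs`). The substitution `c₀ = √T c` turns this into `|β| / √T`.
Uniqueness holds because limits are unique and a meromorphic continuation is determined by its
values on a half-plane. -/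

/-! ### Zeta-regularized products. -/

/-- Two meromorphic functions on `ℂ` that agree on a half-plane and are analytic at `0` have the
same germ at `0`. -/
theorem eventuallyEq_zero_of_eq_on_halfPlane {F G : ℂ → ℂ} {σ : ℝ}
    (hF : MeromorphicOn F Set.univ) (hG : MeromorphicOn G Set.univ)
    (hF0 : AnalyticAt ℂ F 0) (hG0 : AnalyticAt ℂ G 0) (h : ∀ s : ℂ, σ < s.re → F s = G s) :
    F =ᶠ[𝓝 0] G := by
  have hFG : MeromorphicOn (F - G) Set.univ := hF.sub hG
  have h1 : meromorphicOrderAt (F - G) ((σ + 1 : ℝ) : ℂ) = ⊤ := by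
    rw [meromorphicOrderAt_eq_top_iff]
    have ho : IsOpen {s : ℂ | σ < s.re} := isOpen_lt continuous_const Complex.continuous_re
    have : {s : ℂ | σ < s.re} ∈ 𝓝 ((σ + 1 : ℝ) : ℂ) := ho.mem_nhds (by simp)
    filter_upwards [mem_nhdsWithin_of_mem_nhds this] with s hs
    simp [h s hs]
  have h2 : meromorphicOrderAt (F - G) 0 = ⊤ := by
    by_contra h0
    exact hFG.meromorphicOrderAt_ne_top_of_isPreconnected isPreconnected_univ
      (Set.mem_univ 0) (Set.mem_univ _) h0 h1
  rw [meromorphicOrderAt_eq_top_iff] at h2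
  -- Infinite order only gives vanishing on a punctured neighbourhood; analyticity at 0 adds the
  -- centre.
  have h3 : ∀ᶠ z in 𝓝 (0 : ℂ), (F - G) z = 0 :=
    (hF0.sub hG0).frequently_zero_iff_eventually_zero.mp h2.frequently
  filter_upwards [h3] with z hz
  exact sub_eq_zero.mp hz

theorem HasZetaProd.unique {ι : Type*} {a : ι → ℝ} {P Q : ℝ}
    (hP : HasZetaProd a P) (hQ : HasZetaProd a Q) : P = Q := by
  obtain ⟨-, F, σ, hF, hFm, hF0, hPF⟩ := hP
  obtain ⟨-, G, τ, hG, hGm, hG0, hQG⟩ := hQ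
  have h : F =ᶠ[𝓝 0] G := eventuallyEq_zero_of_eq_on_halfPlane (σ := max σ τ) hFm hGm hF0 hG0
    fun s hs => (hF s ((le_max_left _ _).trans_lt hs)).unique (hG s ((le_max_right _ _).trans_lt hs))
  have : (P : ℂ) = Q := by rw [hPF, hQG, h.deriv_eq]
  exact_mod_cast this

theorem hasSum_int_one_div_abs_cpow {s : ℂ} (hs : 1 < s.re) :
    HasSum (fun m : {m : ℤ // m ≠ 0} => 1 / (((m : ℤ).natAbs : ℂ)) ^ s) (2 * riemannZeta s) := by
  have hs0 : s ≠ 0 := by rintro rfl; simp at hs; linarith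
  have h1 : HasSum (fun n : ℕ => 1 / (n : ℂ) ^ s) (riemannZeta s) := by
    rw [zeta_eq_tsum_one_div_nat_cpow hs]
    exact (Complex.summable_one_div_nat_cpow.mpr hs).hasSum
  -- The dropped term `n = 0` is `1 / 0 ^ s = 1 / 0 = 0`.
  have h2 : HasSum (fun n : ℕ => 1 / ((n + 1 : ℕ) : ℂ) ^ s) (riemannZeta s) := by
    have := (hasSum_nat_add_iff' (f := fun n : ℕ => 1 / (n : ℂ) ^ s) 1).mpr h1
    simpa [Complex.zero_cpow hs0] using this
  have h3 : HasSum (fun m : ℤ => 1 / ((m.natAbs : ℂ)) ^ s) (riemannZeta s + riemannZeta s) := by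
    apply HasSum.of_nat_of_neg_add_one
    · simpa using h1
    · convert! h2 using 4 with n
  rw [two_mul]
  refine (hasSum_subtype_iff_of_support_subset (s := {m : ℤ | m ≠ 0}) ?_).mpr h3
  intro m hm
  rintro rfl
  simp [Complex.zero_cpow hs0] at hm

/-- The quotient of the entire function `riemannZeta₁` by `s - 1` equals `ζ` away from 1, and
meromorphy ignores the value at the point itself. -/
theorem meromorphicAt_riemannZeta (s : ℂ) : MeromorphicAt riemannZeta s := by
  have h1 : MeromorphicAt (fun s : ℂ => (s - 1)⁻¹ * riemannZeta₁ s) s :=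
    ((MeromorphicAt.id s).sub (MeromorphicAt.const 1 s)).inv.mul
      (differentiable_riemannZeta₁.analyticAt s).meromorphicAt
  refine h1.congr ?_
  have : ∀ᶠ z in 𝓝[≠] s, z ≠ 1 := by
    rcases eq_or_ne s 1 with rfl | hs
    · exact eventually_mem_nhdsWithin
    · exact mem_nhdsWithin_of_mem_nhds (isOpen_ne.mem_nhds hs)
  filter_upwards [this] with z hz using (riemannZeta_eq_inv_sub_mul hz).symm

/-- Here `Z(s) = 2 C^s ζ(s)`. With `ζ(0) = -1/2` and `ζ'(0) = -log(2π)/2` this gives `Z'(0) = -log C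
- log(2π)`. -/
theorem hasZetaProd_const_div_natAbs {C : ℝ} (hC : 0 < C) :
    HasZetaProd (fun m : {m : ℤ // m ≠ 0} => C / ((m : ℤ).natAbs : ℝ)) (2 * Real.pi * C)⁻¹ := by
  have hC' : (C : ℂ) ≠ 0 := by exact_mod_cast hC.ne'
  have hd : ∀ s : ℂ, s ≠ 1 →
      DifferentiableAt ℂ (fun s : ℂ => 2 * ((C : ℂ) ^ s * riemannZeta s)) s := fun s hs =>
    (((differentiableAt_id.const_cpow (Or.inl hC')).mul
      (differentiableAt_riemannZeta hs)).const_mul 2)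
  refine ⟨fun m => div_pos hC (by exact_mod_cast Int.natAbs_pos.mpr m.2),
    fun s => 2 * ((C : ℂ) ^ s * riemannZeta s), 1, fun s hs => ?_, fun s _ => ?_, ?_, ?_⟩
  · have := (hasSum_int_one_div_abs_cpow hs).mul_left ((C : ℂ) ^ s)
    convert! this using 1
    · ext m
      change ((C / ((m : ℤ).natAbs : ℝ) : ℝ) : ℂ) ^ s = _
      rw [div_eq_mul_inv, Complex.ofReal_mul, Complex.mul_cpow_ofReal_nonneg hC.le (by positivity),
        Complex.ofReal_inv, Complex.ofReal_natCast, Complex.inv_cpow]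
      · rw [one_div]
      rw [Complex.natCast_arg]
      exact Real.pi_pos.ne
    · ring
  · have hA : AnalyticAt ℂ (fun s : ℂ => 2 * (C : ℂ) ^ s) s := by
      refine Differentiable.analyticAt (fun s => ?_) s
      exact (differentiableAt_id.const_cpow (Or.inl hC')).const_mul 2
    refine (hA.meromorphicAt.mul (meromorphicAt_riemannZeta s)).congr (.of_forall fun z => ?_)
    simp [mul_assoc]
  · refine DifferentiableOn.analyticAt (s := {1}ᶜ) (fun s hs => (hd s hs).differentiableWithinAt) ?_
    exact isOpen_compl_singleton.mem_nhds (by simp)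
  · have h1 : HasDerivAt (fun s : ℂ => (C : ℂ) ^ s) ((C : ℂ) ^ (0 : ℂ) * Complex.log C * 1) 0 :=
      (hasDerivAt_id (0 : ℂ)).const_cpow (Or.inl hC')
    have h2 : HasDerivAt riemannZeta (-Complex.log (2 * Real.pi) / 2) 0 := by
      rw [← deriv_riemannZeta_zero]
      exact (differentiableAt_riemannZeta (by simp)).hasDerivAt
    have h3 : HasDerivAt (fun s : ℂ => 2 * ((C : ℂ) ^ s * riemannZeta s)) _ 0 :=
      (h1.mul h2).const_mul 2
    rw [h3.deriv, riemannZeta_zero, Complex.cpow_zero]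
    have e1 : Complex.log (2 * Real.pi) = ((Real.log (2 * Real.pi) : ℝ) : ℂ) := by
      rw [Complex.ofReal_log (by positivity)]; push_cast; rfl
    rw [e1, ← Complex.ofReal_log hC.le]
    have : (2 * (1 * (Real.log C : ℂ) * 1 * (-1 / 2) + 1 * (-(Real.log (2 * Real.pi) : ℂ) / 2)))
        = ((-(Real.log (2 * Real.pi * C)) : ℝ) : ℂ) := by
      rw [Real.log_mul (by positivity) hC.ne']
      push_cast; ring
    rw [this, ← Complex.ofReal_exp, Real.exp_neg, Real.exp_log (by positivity)]

theorem hasZetaProd_modeFactor {T : ℝ} (hT : 0 < T) {β : ℝ} (hβ : β ≠ 0) :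
    HasZetaProd (fun m : {m : ℤ // m ≠ 0} => |T / (2 * Real.pi * ((m : ℤ) : ℝ) * β)|)
      (|β| / T) := by
  have hβ' : 0 < |β| := abs_pos.mpr hβ
  convert! hasZetaProd_const_div_natAbs (C := T / (2 * Real.pi * |β|)) (by positivity) using 1
  · ext m
    have : (0 : ℝ) < |((m : ℤ) : ℝ)| := abs_pos.mpr (by exact_mod_cast m.2)
    rw [Nat.cast_natAbs, Int.cast_abs, abs_div, abs_mul, abs_mul, abs_of_pos hT,
      abs_of_pos Real.two_pi_pos]
    field_simp
  · field_simp

/-! ### Orthonormality and derivatives of the trigonometric basis. -/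

/-- The coefficient `w` for which `basis T m` is the real part of `w • fourier m`. -/
noncomputable def basisCoeff (T : ℝ) (m : ℤ) : ℂ :=
  if m < 0 then (√(2 / T) : ℂ) * Complex.I else if m = 0 then (√(1 / T) : ℂ) else (√(2 / T) : ℂ)

theorem basis_eq_re (T : ℝ) (m : ℤ) (x : AddCircle T) :
    basis T m x = (basisCoeff T m * fourier m x).re := by
  simp only [basis, ContinuousMap.coe_mk, basisCoeff]
  split_ifs with h h0
  · rw [abs_of_neg h, fourier_neg, mul_assoc, Complex.re_ofReal_mul]
    simp
  · subst h0; simp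
  · simp

theorem integral_fourier {T : ℝ} [Fact (0 < T)] (n : ℤ) :
    ∫ x : AddCircle T, fourier n x = if n = 0 then (T : ℂ) else 0 := by
  have hT : T ≠ 0 := (Fact.out : 0 < T).ne'
  have h : fourierCoeff (fourier (T := T) n) 0 = _ := congrFun (fourierCoeff_fourier n) 0
  simp only [fourierCoeff, neg_zero, fourier_zero, one_smul] at h
  rw [AddCircle.integral_haarAddCircle] at h
  have h2 : ∫ x : AddCircle T, fourier n x = (T : ℂ) * Pi.single (M := fun _ => ℂ) n 1 0 := by
    rw [← h, Complex.real_smul, ← mul_assoc, ← Complex.ofReal_mul, mul_inv_cancel₀ hT]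
    simp
  rw [h2]
  by_cases hn : n = 0
  · subst hn; simp
  · rw [Pi.single_eq_of_ne (Ne.symm hn), if_neg hn, mul_zero]

theorem integrable_continuousMap {T : ℝ} [Fact (0 < T)] {E : Type*} [NormedAddCommGroup E]
    {f : AddCircle T → E} (hf : Continuous f) : Integrable f := by
  rw [← integrableOn_univ]
  exact hf.continuousOn.integrableOn_compact isCompact_univ

/-- From `Re u · Re v = ½ Re(uv + u v̄)`, only the frequencies `m + n` and `m - n` occur. When `n =
-m ≠ 0` the surviving coefficient is purely imaginary, so sine and cosine of equal frequency are
orthogonal. -/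
theorem integral_basis_mul_basis {T : ℝ} [Fact (0 < T)] (m n : ℤ) :
    ∫ x : AddCircle T, basis T m x * basis T n x = if m = n then 1 else 0 := by
  have hT : 0 < T := Fact.out
  have h1 : ∀ x : AddCircle T, basis T m x * basis T n x =
      Complex.reCLM ((1 / 2 : ℂ) * (basisCoeff T m * basisCoeff T n * fourier (m + n) x +
        basisCoeff T m * (starRingEnd ℂ) (basisCoeff T n) * fourier (m - n) x)) := by
    intro x
    rw [basis_eq_re, basis_eq_re, fourier_add, sub_eq_add_neg, fourier_add, fourier_neg]
    simp only [Complex.reCLM_apply, Complex.mul_re, Complex.mul_im, Complex.add_re, Complex.add_im,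
      Complex.conj_re, Complex.conj_im, one_div, Complex.inv_re, Complex.inv_im, Complex.re_ofNat,
      Complex.im_ofNat, Complex.normSq_ofNat]
    ring
  simp_rw [h1]
  rw [ContinuousLinearMap.integral_comp_comm _ (integrable_continuousMap (by fun_prop)),
    integral_const_mul, integral_add (integrable_continuousMap (by fun_prop))
    (integrable_continuousMap (by fun_prop)), integral_const_mul, integral_const_mul,
    integral_fourier, integral_fourier]
  have s2 : √(2 / T) * √(2 / T) * T = 2 := by
    rw [Real.mul_self_sqrt (by positivity)]; field_simp
  have s1 : √(1 / T) * √(1 / T) * T = 1 := by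
    rw [Real.mul_self_sqrt (by positivity)]; field_simp
  have e1 : m + n = 0 ↔ n = -m := by omega
  have e2 : m - n = 0 ↔ m = n := sub_eq_zero
  simp only [e1, e2, Complex.reCLM_apply, basisCoeff]
  clear h1
  generalize √(2 / T) = r at *
  generalize √(1 / T) = q at *
  by_cases hmn : m = n
  · subst hmn
    rcases lt_trichotomy m 0 with hm | rfl | hm
    · have : m ≠ -m := by omega
      simp [this, hm]
      linarith
    · simp
      linarith
    · have : m ≠ -m := by omega
      simp [this, hm.ne', hm.not_gt]
      linarith
  · by_cases hn : n = -m
    · subst hn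
      rcases lt_trichotomy m 0 with hm | rfl | hm
      · simp [hmn, hm, hm.ne, hm.not_gt]
      · simp at hmn
      · simp [hmn, hm, hm.ne', hm.not_gt]
    · simp [hmn, hn]

theorem hasDerivAt_basis {T : ℝ} (m : ℤ) (x : AddCircle T) :
    HasDerivAt (fun t : ℝ => basis T m (x + (t : AddCircle T)))
      (-(2 * Real.pi * m / T) * basis T (-m) x) 0 := by
  induction x using QuotientAddGroup.induction_on with | _ τ => ?_
  have h := (hasDerivAt_fourier T m (τ + 0)).comp_const_add τ 0
  have h2 := (Complex.reCLM.hasFDerivAt.comp_hasDerivAt (0 : ℝ)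
    (h.const_mul (basisCoeff T m)))
  -- Multiplication by `i` exchanges the sine and cosine coefficients; the conjugate compensates for
  -- passing from `fourier m` to `fourier (-m)`.
  have key : 2 * Real.pi * Complex.I * m / T * basisCoeff T m =
      -(2 * Real.pi * m / T) * (starRingEnd ℂ) (basisCoeff T (-m)) := by
    rcases lt_trichotomy m 0 with hm | rfl | hm
    · simp [basisCoeff, hm, hm.ne, hm.not_gt]
      ring_nf
      simp
    · simp
    · simp [basisCoeff, hm, hm.ne', hm.not_gt]
      ring
  convert! h2 using 1
  · ext t
    rw [← QuotientAddGroup.mk_add, basis_eq_re]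
    rfl
  · change _ = (basisCoeff T m * (2 * Real.pi * Complex.I * m / T *
      fourier m ((τ + 0 : ℝ) : AddCircle T))).re
    have e : basisCoeff T m * (2 * Real.pi * Complex.I * m / T * fourier m (τ : AddCircle T)) =
        ((-(2 * Real.pi * m / T) : ℝ) : ℂ) *
          (starRingEnd ℂ) (basisCoeff T (-m) * fourier (-m) (τ : AddCircle T)) := by
      rw [map_mul, fourier_neg, Complex.conj_conj, mul_left_comm, ← mul_assoc, ← mul_assoc, key]
      push_cast
      ring
    rw [add_zero, e, Complex.re_ofReal_mul, Complex.conj_re, ← basis_eq_re]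

theorem modeSum_apply (T : ℝ) (S : Finset ℤ) (c : S → ℝ) (x : AddCircle T) :
    modeSum T S c x = ∑ m : S, c m * basis T m x := by
  simp [modeSum]

theorem circleDeriv_modeSum {T : ℝ} (S : Finset ℤ) (c : S → ℝ) (x : AddCircle T) :
    circleDeriv (modeSum T S c) x = ∑ m : S, c m * (-(2 * Real.pi * m / T) * basis T (-m) x) := by
  rw [circleDeriv]
  simp_rw [modeSum_apply]
  exact (HasDerivAt.fun_sum fun (m : S) _ => (hasDerivAt_basis (m : ℤ) x).const_mul (c m)).deriv

theorem integral_modeSum_mul_basis {T : ℝ} [Fact (0 < T)] (S : Finset ℤ) (c : S → ℝ) (n : ℤ) :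
    ∫ x : AddCircle T, modeSum T S c x * basis T n x = ∑ m : S, if (m : ℤ) = n then c m else 0 := by
  simp_rw [modeSum_apply, Finset.sum_mul, mul_assoc]
  rw [integral_finsetSum _ fun m _ => integrable_continuousMap (by fun_prop)]
  simp_rw [integral_const_mul, integral_basis_mul_basis, mul_ite, mul_one, mul_zero]

theorem integral_modeSum_sq {T : ℝ} [Fact (0 < T)] (S : Finset ℤ) (c : S → ℝ) :
    ∫ x : AddCircle T, (modeSum T S c x) ^ 2 = ∑ m : S, c m ^ 2 := by
  have : ∀ x : AddCircle T, (modeSum T S c x) ^ 2 =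
      ∑ m : S, c m * (modeSum T S c x * basis T m x) := by
    intro x
    nth_rw 1 [sq]
    nth_rw 2 [modeSum_apply]
    rw [Finset.mul_sum]
    exact Finset.sum_congr rfl fun m _ => by ring
  simp_rw [this]
  rw [integral_finsetSum _ fun m _ => integrable_continuousMap (by fun_prop)]
  simp_rw [integral_const_mul, integral_modeSum_mul_basis, sq]
  refine Finset.sum_congr rfl fun m _ => ?_
  simp_rw [← Subtype.ext_iff]
  simp

/-! ### The regularized delta as a product of Gaussians. -/

theorem integral_lineMeasure {E : Type*} [NormedAddCommGroup E] [NormedSpace ℝ E] (f : ℝ → E) :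
    ∫ c, f c ∂lineMeasure = (√(2 * Real.pi))⁻¹ • ∫ c, f c := by
  rw [lineMeasure, integral_smul_measure, ENNReal.toReal_ofReal (by positivity)]

theorem integrable_lineMeasure {E : Type*} [NormedAddCommGroup E] {f : ℝ → E}
    (hf : Integrable f) : Integrable f lineMeasure :=
  hf.smul_measure ENNReal.ofReal_ne_top

theorem integral_modeMeasure {E : Type*} [NormedAddCommGroup E] [NormedSpace ℝ E] (S : Finset ℤ)
    (f : (S → ℝ) → E) :
    ∫ c, f c ∂modeMeasure S = (√(2 * Real.pi))⁻¹ ^ S.card • ∫ c, f c := by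
  rw [modeMeasure, integral_smul_measure, ENNReal.toReal_pow,
    ENNReal.toReal_ofReal (by positivity)]

theorem integrable_modeMeasure {E : Type*} [NormedAddCommGroup E] {S : Finset ℤ}
    {f : (S → ℝ) → E} (hf : Integrable f) : Integrable f (modeMeasure S) :=
  hf.smul_measure (ENNReal.pow_ne_top ENNReal.ofReal_ne_top)

theorem integral_modeMeasure_prod (S : Finset ℤ) (f : S → ℝ → ℂ) :
    ∫ c : S → ℝ, ∏ m, f m (c m) ∂modeMeasure S = ∏ m, ∫ x, f m x ∂lineMeasure := by
  rw [integral_modeMeasure, integral_fintype_prod_volume_eq_prod]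
  simp_rw [integral_lineMeasure, Complex.real_smul]
  rw [Finset.prod_mul_distrib]
  simp

/-- The Gaussian regularization of `√(2π) δ(t)`. -/
noncomputable def gaussianDelta (ε t : ℝ) : ℝ := (√ε)⁻¹ * Real.exp (-t ^ 2 / (2 * ε))

theorem integral_exp_lineMeasure {ε : ℝ} (hε : 0 < ε) (t : ℝ) :
    ∫ x : ℝ, Complex.exp (Complex.I * ((x * t : ℝ) : ℂ) - ((ε / 2 * x ^ 2 : ℝ) : ℂ)) ∂lineMeasure =
      (gaussianDelta ε t : ℂ) := by
  have h := _root_.fourierIntegral_gaussian (b := ((ε / 2 : ℝ) : ℂ)) (by simpa using hε) (t : ℂ)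
  have e : ∀ x : ℝ, Complex.exp (Complex.I * ((x * t : ℝ) : ℂ) - ((ε / 2 * x ^ 2 : ℝ) : ℂ)) =
      Complex.exp (Complex.I * t * x) * Complex.exp (-((ε / 2 : ℝ) : ℂ) * x ^ 2) := by
    intro x
    rw [← Complex.exp_add]
    congr 1
    push_cast
    ring
  simp_rw [integral_lineMeasure, e]
  rw [h, Complex.real_smul, gaussianDelta]
  have e1 : ((Real.pi : ℂ) / ((ε / 2 : ℝ) : ℂ)) ^ (1 / 2 : ℂ) = ((√(2 * Real.pi) / √ε : ℝ) : ℂ) := by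
    rw [← Real.sqrt_div (by positivity), Real.sqrt_eq_rpow, Complex.ofReal_cpow (by positivity)]
    congr 1
    · push_cast; field_simp
    · simp
  rw [e1, ← mul_assoc, ← Complex.ofReal_mul]
  have e2 : (√(2 * Real.pi))⁻¹ * (√(2 * Real.pi) / √ε) = (√ε)⁻¹ := by field_simp
  rw [e2, Complex.ofReal_mul, Complex.ofReal_exp]
  congr 2
  push_cast
  ring

/-- Orthonormality makes the exponent a sum over the modes, so the integral factors into
one-dimensional Gaussian Fourier transforms. -/
theorem modeDelta_eq {T : ℝ} [Fact (0 < T)] (R : Finset ℤ) {ε : ℝ} (hε : 0 < ε)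
    {ψ : AddCircle T → ℝ} (hψ : Continuous ψ) :
    modeDelta T R ε ψ = ∏ r : R, (gaussianDelta ε (∫ x, basis T r x * ψ x) : ℂ) := by
  have h : ∀ ρ : R → ℝ, ∫ x : AddCircle T, modeSum T R ρ x * ψ x =
      ∑ r : R, ρ r * ∫ x, basis T r x * ψ x := by
    intro ρ
    simp_rw [modeSum_apply, Finset.sum_mul, mul_assoc]
    rw [integral_finsetSum _ fun m _ => integrable_continuousMap (by fun_prop)]
    simp_rw [integral_const_mul]
  simp_rw [modeDelta, h, integral_modeSum_sq, ← integral_exp_lineMeasure hε]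
  rw [← integral_modeMeasure_prod]
  congr 1
  ext ρ
  rw [← Complex.exp_sum, Finset.sum_sub_distrib, ← Finset.mul_sum, Finset.mul_sum]
  push_cast
  rfl

/-- The angular frequency `2πm/T` of the mode `m`, multiplied by `β`. -/
noncomputable def modeRate (T β : ℝ) (m : ℤ) : ℝ := 2 * Real.pi * m * β / T

/-- The delta runs over the negated modes because the derivative of `e_m` lies along `e_{-m}`. The
minus sign is lost since the Gaussian is even. -/
theorem modeDelta_circleDeriv {T : ℝ} [Fact (0 < T)] (S : Finset ℤ) (β : ℝ) {ε : ℝ} (hε : 0 < ε)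
    (c : S → ℝ) :
    modeDelta T ((S.erase 0).image Neg.neg) ε
      (fun x => β * circleDeriv (modeSum T S c) x) =
    ∏ m : S, ((if (m : ℤ) = 0 then 1 else gaussianDelta ε (modeRate T β m * c m) : ℝ) : ℂ) := by
  simp_rw [circleDeriv_modeSum]
  rw [modeDelta_eq _ hε (by fun_prop)]
  have h : ∀ m : S, ∫ x : AddCircle T, basis T (-m) x *
      (β * ∑ n : S, c n * (-(2 * Real.pi * n / T) * basis T (-n) x)) = - (modeRate T β m * c m) := by
    intro m
    have : ∀ x : AddCircle T, basis T (-m) x *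
      (β * ∑ n : S, c n * (-(2 * Real.pi * n / T) * basis T (-n) x)) =
      ∑ n : S, (β * (c n * -(2 * Real.pi * n / T))) * (basis T (-m) x * basis T (-n) x) := by
      intro x
      rw [Finset.mul_sum, Finset.mul_sum]
      exact Finset.sum_congr rfl fun n _ => by ring
    simp_rw [this]
    rw [integral_finsetSum _ fun n _ => integrable_continuousMap (by fun_prop)]
    simp_rw [integral_const_mul, integral_basis_mul_basis, neg_inj, ← Subtype.ext_iff]
    simp [modeRate]
    ring
  rw [Finset.prod_coe_sort ((S.erase 0).image Neg.neg) (fun r : ℤ => (gaussianDelta ε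
    (∫ x : AddCircle T, basis T r x *
      (β * ∑ n : S, c n * (-(2 * Real.pi * n / T) * basis T (-n) x))) : ℂ)),
    Finset.prod_image (fun a _ b _ hab => neg_injective hab)]
  rw [← Finset.prod_subset (Finset.subset_univ (Finset.univ.filter fun m : S => (m : ℤ) ≠ 0))]
  · refine Finset.prod_bij' (fun m hm => ⟨m, Finset.mem_of_mem_erase hm⟩) (fun m _ => m) ?_ ?_ ?_ ?_ ?_
    · intro m hm; simpa using Finset.ne_of_mem_erase hm
    · intro m hm; simpa using hm
    · simp
    · simp
    · intro m hm
      rw [h ⟨m, Finset.mem_of_mem_erase hm⟩, if_neg (Finset.ne_of_mem_erase hm), gaussianDelta,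
        gaussianDelta, neg_sq]
  · intro m _ hm
    simp at hm
    simp [hm]

/-! ### Change of variables under coordinatewise scaling. -/

section Rescaling

variable {ι : Type*} [Fintype ι]

/-- Coordinatewise multiplication by nonzero numbers. -/
noncomputable def piMulHomeomorph (D : ι → ℝ) (hD : ∀ i, D i ≠ 0) : (ι → ℝ) ≃ₜ (ι → ℝ) :=
  Homeomorph.piCongrRight fun i => Homeomorph.mulLeft₀ (D i) (hD i)

theorem map_piMulHomeomorph (D : ι → ℝ) (hD : ∀ i, D i ≠ 0) :
    Measure.map (piMulHomeomorph D hD) (volume : Measure (ι → ℝ)) =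
      ENNReal.ofReal |(∏ i, D i)⁻¹| • volume := by
  classical
  have h0 : (Matrix.diagonal D).det ≠ 0 := by
    rw [Matrix.det_diagonal]; exact Finset.prod_ne_zero_iff.mpr fun i _ => hD i
  have h := Real.map_matrix_volume_pi_eq_smul_volume_pi h0
  rw [Matrix.det_diagonal] at h
  rw [← h]
  congr 1
  ext y i
  simp [piMulHomeomorph, Matrix.mulVec_diagonal]

theorem integrable_comp_piMul {E : Type*} [NormedAddCommGroup E] {D : ι → ℝ} (hD : ∀ i, D i ≠ 0)
    {F : (ι → ℝ) → E} : Integrable (fun y : ι → ℝ => F fun i => D i * y i) ↔ Integrable F := by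
  have h := (piMulHomeomorph D hD).measurableEmbedding.integrable_map_iff (g := F) (μ := volume)
  rw [map_piMulHomeomorph, integrable_smul_measure _ ENNReal.ofReal_ne_top] at h
  · exact h.symm
  · simpa using (Finset.prod_ne_zero_iff.mpr fun i _ => hD i)

theorem integral_comp_piMul {E : Type*} [NormedAddCommGroup E] [NormedSpace ℝ E] {D : ι → ℝ}
    (hD : ∀ i, D i ≠ 0) (F : (ι → ℝ) → E) :
    ∫ y : ι → ℝ, F (fun i => D i * y i) = |(∏ i, D i)⁻¹| • ∫ y, F y := by
  have h := (piMulHomeomorph D hD).measurableEmbedding.integral_map (μ := volume) F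
  rw [map_piMulHomeomorph, integral_smul_measure, ENNReal.toReal_ofReal (abs_nonneg _)] at h
  exact h.symm

end Rescaling

/-! ### Concentration of the regularized deltas as `ε → 0⁺`. -/

section Concentration

variable {ι : Type*} (p : ι → Prop) [DecidablePred p]

/-- The scale on which `gaussianDelta ε (a i * c i)` varies in `c i`. -/
noncomputable def deltaScale (a : ι → ℝ) (ε : ℝ) (i : ι) : ℝ := if p i then 1 else √ε / |a i|

variable {p}

theorem deltaScale_pos {a : ι → ℝ} (ha : ∀ i, ¬ p i → a i ≠ 0) {ε : ℝ} (hε : 0 < ε) (i : ι) :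
    0 < deltaScale p a ε i := by
  rw [deltaScale]
  split_ifs with h
  · exact one_pos
  · exact div_pos (Real.sqrt_pos.mpr hε) (abs_pos.mpr (ha i h))

variable [Fintype ι]

/-- The product of regularized delta functions of `a i * c i` over the coordinates outside `p`. -/
noncomputable def deltaProd (p : ι → Prop) [DecidablePred p] (a : ι → ℝ) (ε : ℝ) (c : ι → ℝ) : ℝ :=
  ∏ i, if p i then 1 else gaussianDelta ε (a i * c i)

/-- Jacobian times rescaled delta is free of `ε`, which makes a fixed dominating function possible.
-/
theorem prod_deltaScale_mul_deltaProd {a : ι → ℝ} (ha : ∀ i, ¬ p i → a i ≠ 0) {ε : ℝ} (hε : 0 < ε)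
    (y : ι → ℝ) :
    (∏ i, deltaScale p a ε i) * deltaProd p a ε (fun i => deltaScale p a ε i * y i) =
      ∏ i, if p i then 1 else |a i|⁻¹ * Real.exp (-y i ^ 2 / 2) := by
  rw [deltaProd, ← Finset.prod_mul_distrib]
  refine Finset.prod_congr rfl fun i _ => ?_
  by_cases h : p i
  · simp [deltaScale, h]
  · have ha' := abs_pos.mpr (ha i h)
    have hs := Real.sqrt_pos.mpr hε
    simp only [deltaScale, h, if_false, gaussianDelta]
    have e : -(a i * (√ε / |a i| * y i)) ^ 2 / (2 * ε) = -y i ^ 2 / 2 := by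
      rw [mul_pow, mul_pow, div_pow, sq_abs, Real.sq_sqrt hε.le]
      have := ha i h
      field_simp
    rw [e]
    field_simp

theorem eventually_integrable_and_tendsto_integral_deltaProd_mul {a : ι → ℝ}
    (ha : ∀ i, ¬ p i → a i ≠ 0) {h : (ι → ℝ) → ℂ} (hh : Continuous h) {g : ℝ → ℝ}
    (hg : Integrable g) (hg0 : ∀ x, 0 ≤ g x) {K : ℝ}
    (hb : ∀ c, ‖h c‖ ≤ ∏ i, if p i then g (c i) else Real.exp (K * c i ^ 2)) :
    (∀ᶠ ε in 𝓝[>] (0 : ℝ), Integrable fun c => (deltaProd p a ε c : ℂ) * h c) ∧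
    Tendsto (fun ε : ℝ => ∫ c, (deltaProd p a ε c : ℂ) * h c) (𝓝[>] 0)
      (𝓝 (∫ y : ι → ℝ, ((∏ i, if p i then 1 else |a i|⁻¹ * Real.exp (-y i ^ 2 / 2) : ℝ) : ℂ) *
        h fun i => if p i then y i else 0)) := by
  set G : (ι → ℝ) → ℝ := fun y => ∏ i, if p i then 1 else |a i|⁻¹ * Real.exp (-y i ^ 2 / 2) with hG
  have hGc : Continuous G := by
    refine continuous_finsetProd _ fun i _ => ?_
    split_ifs <;> fun_prop
  have hG0 : ∀ y, 0 ≤ G y := fun y => Finset.prod_nonneg fun i _ => by split_ifs <;> positivity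
  -- Half of the Gaussian decay `exp(-y²/2)` is spent on absorbing the growth of `h`; `exp(-y²/4)`
  -- remains.
  set B : (ι → ℝ) → ℝ := fun y => ∏ i, if p i then g (y i) else
    |a i|⁻¹ * Real.exp (-(1 / 4) * y i ^ 2) with hB
  have hBi : Integrable B := by
    refine Integrable.fintype_prod (f := fun i x => if p i then g x else
      |a i|⁻¹ * Real.exp (-(1 / 4) * x ^ 2)) fun i => ?_
    by_cases hp : p i
    · simpa [hp] using hg
    · simpa only [hp, if_false] using (integrable_exp_neg_mul_sq (by norm_num)).const_mul _
  have hpos : ∀ᶠ ε in 𝓝[>] (0 : ℝ), 0 < ε := eventually_mem_nhdsWithin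
  -- Ranging over all `i` is harmless: if `a i = 0`, possible only for `p i`, the quotient is 0.
  have hsmall : ∀ᶠ ε in 𝓝[>] (0 : ℝ), ∀ i, K * (√ε / |a i|) ^ 2 ≤ 1 / 4 := by
    rw [eventually_all]
    intro i
    have : Tendsto (fun ε : ℝ => K * (√ε / |a i|) ^ 2) (𝓝[>] 0) (𝓝 (K * (√0 / |a i|) ^ 2)) :=
      Continuous.continuousWithinAt (by fun_prop)
    exact this.eventually (ge_mem_nhds (by simp))
  have hbound : ∀ᶠ ε in 𝓝[>] (0 : ℝ), ∀ y : ι → ℝ,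
      ‖(G y : ℂ) * h (fun i => deltaScale p a ε i * y i)‖ ≤ B y := by
    filter_upwards [hpos, hsmall] with ε hε hεs y
    rw [norm_mul, Complex.norm_real, Real.norm_of_nonneg (hG0 y)]
    refine (mul_le_mul_of_nonneg_left (hb _) (hG0 y)).trans ?_
    rw [hG, hB, ← Finset.prod_mul_distrib]
    refine Finset.prod_le_prod (fun i _ => ?_) fun i _ => ?_
    · split_ifs
      · simpa using hg0 _
      · positivity
    · by_cases hp : p i
      · simp [hp, deltaScale]
      · simp only [hp, if_false, deltaScale]
        rw [mul_assoc, ← Real.exp_add]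
        gcongr
        have := mul_le_mul_of_nonneg_right (hεs i) (sq_nonneg (y i))
        rw [mul_pow]
        linarith
  have hmeas : ∀ ε, AEStronglyMeasurable
      (fun y : ι → ℝ => (G y : ℂ) * h (fun i => deltaScale p a ε i * y i)) := fun ε =>
    Continuous.aestronglyMeasurable (by fun_prop)
  have hresc : ∀ ε, 0 < ε → (fun y : ι → ℝ => (G y : ℂ) * h (fun i => deltaScale p a ε i * y i)) =
      fun y => ((∏ i, deltaScale p a ε i : ℝ) : ℂ) *
        (fun c => (deltaProd p a ε c : ℂ) * h c) fun i => deltaScale p a ε i * y i := by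
    intro ε hε
    ext y
    rw [← mul_assoc, ← Complex.ofReal_mul, prod_deltaScale_mul_deltaProd ha hε]
  have hPpos : ∀ ε, 0 < ε → 0 < ∏ i, deltaScale p a ε i := fun ε hε =>
    Finset.prod_pos fun i _ => deltaScale_pos ha hε i
  constructor
  · filter_upwards [hpos, hbound] with ε hε hεb
    rw [← integrable_comp_piMul fun i => (deltaScale_pos ha hε i).ne']
    have hi := hBi.mono' (hmeas ε) (.of_forall hεb)
    rw [hresc ε hε] at hi
    have hu : IsUnit (((∏ i, deltaScale p a ε i : ℝ) : ℂ)) :=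
      isUnit_iff_ne_zero.mpr (Complex.ofReal_ne_zero.mpr (hPpos ε hε).ne')
    exact (integrable_const_mul_iff hu _).mp hi
  · have hlim : Tendsto (fun ε : ℝ => ∫ y : ι → ℝ,
        (G y : ℂ) * h (fun i => deltaScale p a ε i * y i)) (𝓝[>] 0)
        (𝓝 (∫ y : ι → ℝ, (G y : ℂ) * h fun i => if p i then y i else 0)) := by
      refine tendsto_integral_filter_of_dominated_convergence B (.of_forall hmeas)
        (hbound.mono fun ε h => .of_forall h) hBi (.of_forall fun y => ?_)
      refine tendsto_const_nhds.mul ((hh.tendsto _).comp (tendsto_pi_nhds.mpr fun i => ?_))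
      by_cases hp : p i
      · simp [deltaScale, hp]
      · have : Tendsto (fun ε : ℝ => √ε / |a i| * y i) (𝓝[>] 0) (𝓝 (√0 / |a i| * y i)) :=
          Continuous.continuousWithinAt (by fun_prop)
        simpa [deltaScale, hp] using this
    refine hlim.congr' ?_
    filter_upwards [hpos] with ε hε
    rw [hresc ε hε, integral_const_mul,
      integral_comp_piMul (fun i => (deltaScale_pos ha hε i).ne')
        (fun c => (deltaProd p a ε c : ℂ) * h c),
      abs_of_pos (inv_pos.mpr (hPpos ε hε)), Complex.real_smul, ← mul_assoc, ← Complex.ofReal_mul,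
      mul_inv_cancel₀ (hPpos ε hε).ne', Complex.ofReal_one, one_mul]

end Concentration

/-! ### Integrals over finitely many modes. -/

theorem abs_modeRate_inv (T β : ℝ) (m : ℤ) :
    |modeRate T β m|⁻¹ = |T / (2 * Real.pi * m * β)| := by
  rw [← abs_inv, modeRate, inv_div]

theorem modeRate_ne_zero {T : ℝ} (hT : 0 < T) {β : ℝ} (hβ : β ≠ 0) {m : ℤ} (hm : m ≠ 0) :
    modeRate T β m ≠ 0 := by
  have : (m : ℝ) ≠ 0 := by exact_mod_cast hm
  have := Real.pi_ne_zero
  unfold modeRate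
  positivity

theorem continuous_toL2_modeSum {T : ℝ} [Fact (0 < T)] (S : Finset ℤ) :
    Continuous fun c : S → ℝ => toL2 T (modeSum T S c) := by
  unfold toL2 modeSum
  refine (ContinuousMap.toLp (E := ℝ) 2 (volume : Measure (AddCircle T)) ℝ).continuous.comp ?_
  fun_prop

theorem integral_exp_neg_sq_div_two_lineMeasure (r : ℝ) :
    ∫ x : ℝ, ((r * Real.exp (-x ^ 2 / 2) : ℝ) : ℂ) ∂lineMeasure = (r : ℂ) := by
  rw [integral_complex_ofReal, integral_const_mul, integral_lineMeasure]
  have e : ∀ x : ℝ, Real.exp (-x ^ 2 / 2) = Real.exp (-(1 / 2) * x ^ 2) := fun x => by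
    congr 1; ring
  simp_rw [e]
  rw [integral_gaussian, smul_eq_mul]
  have : √(Real.pi / (1 / 2)) = √(2 * Real.pi) := by congr 1; ring
  rw [this, inv_mul_cancel₀ (by positivity), mul_one]

/-- The bound and `k` enter as products over `S` so that one statement serves both `0 ∈ S` (the
cutoff integrals) and `0 ∉ S` (a single mode factor, where the homogeneous factor is absent). -/
theorem hasModeIntegral_of_bound {T : ℝ} [Fact (0 < T)] {β : ℝ} (hβ : β ≠ 0) (S : Finset ℤ)
    {f : L2 T → ℂ} (hf : Continuous f) {g : ℝ → ℝ} (hg : Integrable g) (hg0 : ∀ x, 0 ≤ g x) {K : ℝ}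
    (hb : ∀ c : S → ℝ, ‖f (toL2 T (modeSum T S c))‖ ≤
      ∏ m : S, if (m : ℤ) = 0 then g (c m) else Real.exp (K * c m ^ 2))
    {k : ℝ → ℂ} (hk : ∀ c : S → ℝ, f (toL2 T (modeSum T S fun m => if (m : ℤ) = 0 then c m else 0)) =
      ∏ m : S, if (m : ℤ) = 0 then k (c m) else 1) :
    HasModeIntegral T S ((S.erase 0).image Neg.neg) β f
      (∏ m ∈ S, if m = 0 then ∫ x, k x ∂lineMeasure else ((|T / (2 * Real.pi * m * β)| : ℝ) : ℂ)) := by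
  have hT : 0 < T := Fact.out
  obtain ⟨h1, h2⟩ := eventually_integrable_and_tendsto_integral_deltaProd_mul
    (p := fun m : S => (m : ℤ) = 0) (a := fun m : S => modeRate T β m)
    (fun m hm => modeRate_ne_zero hT hβ hm) (hf.comp (continuous_toL2_modeSum S)) hg hg0 hb
  have hpos : ∀ᶠ ε in 𝓝[>] (0 : ℝ), 0 < ε := eventually_mem_nhdsWithin
  have he : ∀ ε : ℝ, 0 < ε → modeIntegrand T S ((S.erase 0).image Neg.neg) β f ε =
      fun c => (deltaProd (fun m : S => (m : ℤ) = 0) (fun m : S => modeRate T β m) ε c : ℂ) *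
        (f ∘ fun c => toL2 T (modeSum T S c)) c := by
    intro ε hε
    ext c
    rw [modeIntegrand, modeDelta_circleDeriv S β hε, deltaProd, Complex.ofReal_prod]
    rfl
  constructor
  · filter_upwards [hpos, h1] with ε hε hi
    rw [he ε hε]
    exact integrable_modeMeasure hi
  · have hlim := h2.const_smul ((√(2 * Real.pi))⁻¹ ^ S.card)
    rw [← integral_modeMeasure] at hlim
    have hval : ∫ y : S → ℝ, ((∏ m : S, if (m : ℤ) = 0 then 1 else
          |modeRate T β m|⁻¹ * Real.exp (-y m ^ 2 / 2) : ℝ) : ℂ) *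
        (f ∘ fun c => toL2 T (modeSum T S c)) (fun m => if (m : ℤ) = 0 then y m else 0)
          ∂modeMeasure S =
        ∏ m ∈ S, if m = 0 then ∫ x, k x ∂lineMeasure else
          ((|T / (2 * Real.pi * m * β)| : ℝ) : ℂ) := by
      rw [← Finset.prod_coe_sort S]
      have : ∀ m : S, (if (m : ℤ) = 0 then ∫ x, k x ∂lineMeasure else
          ((|T / (2 * Real.pi * (m : ℤ) * β)| : ℝ) : ℂ)) = ∫ x : ℝ, (if (m : ℤ) = 0 then k x else
            ((|modeRate T β m|⁻¹ * Real.exp (-x ^ 2 / 2) : ℝ) : ℂ)) ∂lineMeasure := by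
        intro m
        split_ifs
        · rfl
        · rw [integral_exp_neg_sq_div_two_lineMeasure, abs_modeRate_inv]
      simp_rw [this]
      rw [← integral_modeMeasure_prod]
      congr 1
      ext y
      rw [Function.comp_apply, hk, Complex.ofReal_prod, ← Finset.prod_mul_distrib]
      refine Finset.prod_congr rfl fun m _ => ?_
      split_ifs <;> simp
    rw [hval] at hlim
    refine hlim.congr' ?_
    filter_upwards [hpos] with ε hε
    rw [he ε hε, integral_modeMeasure]

theorem isModeFactor {T : ℝ} [Fact (0 < T)] {β : ℝ} (hβ : β ≠ 0) {m : ℤ} (hm : m ≠ 0) :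
    IsModeFactor T β m |T / (2 * Real.pi * m * β)| := by
  -- The choices of `g` and `k` are immaterial, as no coordinate has index 0.
  have h := hasModeIntegral_of_bound (T := T) hβ {m} (f := fun _ => 1) continuous_const
    (g := fun _ => 0) (integrable_zero _ _ _) (fun _ => le_rfl) (K := 0) (k := fun _ => 1)
    (fun c => by simp [hm]) (fun c => by simp)
  rw [Finset.prod_singleton, if_neg hm,
    Finset.erase_eq_of_notMem (by simpa using hm.symm), Finset.image_singleton] at h
  exact h

theorem image_neg_erase_cutoff (N : ℕ) : ((cutoff N).erase 0).image Neg.neg = inhCutoff N := by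
  ext m
  simp only [inhCutoff, cutoff, Finset.mem_image, Finset.mem_erase, Finset.mem_Icc]
  constructor
  · rintro ⟨n, h, rfl⟩; omega
  · intro h; exact ⟨-m, by omega, by omega⟩

theorem norm_toL2_sq {T : ℝ} [Fact (0 < T)] (n : C(AddCircle T, ℝ)) :
    ‖toL2 T n‖ ^ 2 = ∫ x, n x ^ 2 := by
  rw [← real_inner_self_eq_norm_sq, toL2, ContinuousMap.inner_toLp]
  simp [sq]

theorem integral_toL2 {T : ℝ} [Fact (0 < T)] (n : C(AddCircle T, ℝ)) :
    ∫ x, toL2 T n x = ∫ x, n x :=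
  integral_congr_ae (ContinuousMap.coeFn_toLp (volume : Measure (AddCircle T)) n)

theorem basis_zero (T : ℝ) : basis T 0 = ContinuousMap.const _ √(1 / T) := by
  ext x; simp [basis]

theorem toL2_smul_basis_zero {T : ℝ} [Fact (0 < T)] (c : ℝ) :
    toL2 T (c • basis T 0) = constL2 T (√(1 / T) * c) := by
  rw [constL2, basis_zero]
  congr 1
  ext x
  simp [mul_comm]

theorem continuous_constL2 {T : ℝ} [Fact (0 < T)] : Continuous (constL2 T) := by
  have : constL2 T = fun c => c • toL2 T 1 := by
    ext1 c
    rw [constL2, toL2, toL2, ← map_smul]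
    congr 1
    ext x; simp
  rw [this]
  fun_prop

theorem modeSum_ite_zero {T : ℝ} (S : Finset ℤ) (h0 : (0 : ℤ) ∈ S) (c : S → ℝ) :
    modeSum T S (fun m => if (m : ℤ) = 0 then c m else 0) = c ⟨0, h0⟩ • basis T 0 := by
  rw [modeSum, Finset.sum_eq_single ⟨0, h0⟩]
  · simp
  · intro m _ hm
    rw [if_neg fun h => hm (Subtype.ext h), zero_smul]
  · simp

/-- The homogeneous part `c_0 e_0` is the constant `c_0 / √T`; by Parseval the exponential of the
squared norm of the remainder splits over the modes. -/
theorem norm_apply_toL2_modeSum_le {T : ℝ} [Fact (0 < T)] {f : L2 T → ℂ} {g : ℝ → ℝ} {K : ℝ}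
    (hb : ∀ (c : ℝ) (v : L2 T), (∫ x : AddCircle T, v x) = 0 →
      ‖f (constL2 T c + v)‖ ≤ g c * Real.exp (K * ‖v‖ ^ 2))
    (S : Finset ℤ) (h0 : (0 : ℤ) ∈ S) (c : S → ℝ) :
    ‖f (toL2 T (modeSum T S c))‖ ≤
      ∏ m : S, if (m : ℤ) = 0 then g (√(1 / T) * c m) else Real.exp (K * c m ^ 2) := by
  have hT : 0 < T := Fact.out
  set d : S → ℝ := fun m => if (m : ℤ) = 0 then 0 else c m with hd
  have hsplit : toL2 T (modeSum T S c) =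
      constL2 T (√(1 / T) * c ⟨0, h0⟩) + toL2 T (modeSum T S d) := by
    rw [← toL2_smul_basis_zero, ← modeSum_ite_zero S h0, toL2, toL2, toL2, ← map_add]
    congr 1
    rw [modeSum, modeSum, modeSum, ← Finset.sum_add_distrib]
    refine Finset.sum_congr rfl fun m _ => ?_
    simp only [hd]
    split_ifs <;> simp
  have hint : ∫ x, toL2 T (modeSum T S d) x = 0 := by
    rw [integral_toL2]
    have h := integral_modeSum_mul_basis (T := T) S d 0
    have hz : ∑ m : S, (if (m : ℤ) = 0 then d m else 0) = 0 :=
      Finset.sum_eq_zero fun m _ => by simp +contextual [hd]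
    rw [hz, basis_zero] at h
    simp only [ContinuousMap.const_apply] at h
    rw [integral_mul_const] at h
    exact (mul_eq_zero.mp h).resolve_right (by positivity)
  have hnorm : ‖toL2 T (modeSum T S d)‖ ^ 2 = ∑ m : S, d m ^ 2 := by
    rw [norm_toL2_sq, integral_modeSum_sq]
  rw [hsplit]
  refine (hb _ _ hint).trans_eq ?_
  rw [hnorm, Finset.mul_sum, Real.exp_sum, ← Finset.mul_prod_erase _ _ (Finset.mem_univ ⟨0, h0⟩),
    ← Finset.mul_prod_erase _ (fun m : S => if (m : ℤ) = 0 then _ else _)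
      (Finset.mem_univ ⟨0, h0⟩)]
  simp only [hd, if_true]
  rw [zero_pow two_ne_zero, mul_zero, Real.exp_zero, one_mul]
  congr 1
  refine Finset.prod_congr rfl fun m hm => ?_
  have : (m : ℤ) ≠ 0 := fun h => Finset.ne_of_mem_erase hm (Subtype.ext h)
  simp [this]

theorem hasModeIntegral_cutoff {T : ℝ} [Fact (0 < T)] {β : ℝ} (hβ : β ≠ 0)
    {f : L2 T → ℂ} (hf : IsTestFunctional T f) (N : ℕ) :
    HasModeIntegral T (cutoff N) (inhCutoff N) β f
      ((∫ c : ℝ, f (toL2 T (c • basis T 0)) ∂lineMeasure) *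
        ∏ m ∈ inhCutoff N, ((|T / (2 * Real.pi * m * β)| : ℝ) : ℂ)) := by
  have hT : 0 < T := Fact.out
  obtain ⟨hfc, g, K, hg, hb⟩ := hf
  have h0 : (0 : ℤ) ∈ cutoff N := by simp [cutoff]
  -- Nonnegativity of `g` is forced by the bound at `v = 0`.
  have hg0 : ∀ x, 0 ≤ g x := fun x => by
    have := (norm_nonneg _).trans (hb x 0 (by
      rw [integral_congr_ae (Lp.coeFn_zero _ _ _)]; simp))
    simpa using this
  have h := hasModeIntegral_of_bound hβ (cutoff N) hfc
    (hg.comp_mul_left' (R := √(1 / T)) (by positivity)) (fun x => hg0 _)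
    (norm_apply_toL2_modeSum_le hb (cutoff N) h0)
    (k := fun c => f (toL2 T (c • basis T 0))) (fun c => by
      rw [modeSum_ite_zero _ h0, Finset.prod_eq_single ⟨0, h0⟩]
      · simp
      · intro m _ hm
        exact if_neg fun h => hm (Subtype.ext h)
      · simp)
  rw [image_neg_erase_cutoff, ← Finset.mul_prod_erase _ _ h0, if_pos rfl] at h
  convert! h using 2
  refine Finset.prod_congr rfl fun m hm => ?_
  rw [if_neg (Finset.ne_of_mem_erase hm)]

theorem HasModeIntegral.unique {T : ℝ} [Fact (0 < T)] {S R : Finset ℤ} {β : ℝ} {f : L2 T → ℂ}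
    {I J : ℂ} (hI : HasModeIntegral T S R β f I) (hJ : HasModeIntegral T S R β f J) : I = J :=
  tendsto_nhds_unique hI.2 hJ.2

theorem integral_apply_smul_basis_zero {T : ℝ} [Fact (0 < T)] (f : L2 T → ℂ) :
    ∫ c : ℝ, f (toL2 T (c • basis T 0)) ∂lineMeasure =
      (√T : ℂ) * ∫ c : ℝ, f (constL2 T c) ∂lineMeasure := by
  have hT : 0 < T := Fact.out
  simp_rw [toL2_smul_basis_zero, integral_lineMeasure]
  rw [Measure.integral_comp_mul_left (fun c => f (constL2 T c)), Real.sqrt_div zero_le_one,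
    Real.sqrt_one, one_div, inv_inv, abs_of_nonneg (Real.sqrt_nonneg T)]
  simp only [Complex.real_smul]
  ring

theorem integrable_apply_constL2 {T : ℝ} [Fact (0 < T)] {f : L2 T → ℂ}
    (hf : IsTestFunctional T f) : Integrable (fun c : ℝ => f (constL2 T c)) lineMeasure := by
  obtain ⟨hfc, g, K, hg, hb⟩ := hf
  refine integrable_lineMeasure (hg.mono' (hfc.comp continuous_constL2).aestronglyMeasurable ?_)
  refine .of_forall fun c => ?_
  have := hb c 0 (by rw [integral_congr_ae (Lp.coeFn_zero _ _ _)]; simp)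
  simpa using this

/-! ### Existence and uniqueness of the path integral. -/

theorem hasDeltaPathIntegral_iff {T : ℝ} [Fact (0 < T)] {β : ℝ} (hβ : β ≠ 0)
    {f : L2 T → ℂ} (hf : IsTestFunctional T f) (I : ℂ) :
    HasDeltaPathIntegral T β f I ↔
      I = ((|β| / T : ℝ) : ℂ) * ∫ c : ℝ, f (toL2 T (c • basis T 0)) ∂lineMeasure := by
  have hT : 0 < T := Fact.out
  have hquot : ∀ N : ℕ, (∫ c : ℝ, f (toL2 T (c • basis T 0)) ∂lineMeasure) *
      (∏ m ∈ inhCutoff N, ((|T / (2 * Real.pi * m * β)| : ℝ) : ℂ)) /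
        ∏ m ∈ inhCutoff N, ((|T / (2 * Real.pi * m * β)| : ℝ) : ℂ) =
      ∫ c : ℝ, f (toL2 T (c • basis T 0)) ∂lineMeasure := by
    intro N
    refine mul_div_cancel_right₀ _ (Finset.prod_ne_zero_iff.mpr fun m hm => ?_)
    rw [← abs_modeRate_inv]
    exact Complex.ofReal_ne_zero.mpr (inv_ne_zero (abs_ne_zero.mpr
      (modeRate_ne_zero hT hβ (Finset.ne_of_mem_erase hm))))
  constructor
  · rintro ⟨z, P, J, L, hz, hP, hJ, hL, rfl⟩
    -- Uniqueness of each ingredient in turn: the mode factors, then their regularized product, then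
    -- the limit.
    have hz' : ∀ m : ℤ, m ≠ 0 → z m = |T / (2 * Real.pi * m * β)| := fun m hm => by
      exact_mod_cast (hz m hm).unique (isModeFactor hβ hm)
    have hP' : P = |β| / T := by
      have e : (fun m : {m : ℤ // m ≠ 0} => z m) =
          fun m : {m : ℤ // m ≠ 0} => |T / (2 * Real.pi * ((m : ℤ) : ℝ) * β)| :=
        funext fun m => hz' m m.2
      rw [e] at hP
      exact hP.unique (hasZetaProd_modeFactor hT hβ)
    rw [hP']
    congr 1
    refine tendsto_nhds_unique hL (tendsto_const_nhds.congr fun N => ?_)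
    have hprod : ∏ m ∈ inhCutoff N, (z m : ℂ) =
        ∏ m ∈ inhCutoff N, ((|T / (2 * Real.pi * m * β)| : ℝ) : ℂ) :=
      Finset.prod_congr rfl fun m hm => by rw [hz' m (Finset.ne_of_mem_erase hm)]
    rw [(hJ N).unique (hasModeIntegral_cutoff hβ hf N), hprod, hquot]
  · rintro rfl
    exact ⟨fun m => |T / (2 * Real.pi * m * β)|, |β| / T, _, _, fun m hm => isModeFactor hβ hm,
      hasZetaProd_modeFactor hT hβ, hasModeIntegral_cutoff hβ hf,
      tendsto_const_nhds.congr fun N => (hquot N).symm, rfl⟩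

end CircleDelta

theorem theorem2 (T : ℝ) [Fact (0 < T)] (β : ℝ) (hβ : β ≠ 0)
    (f : L2 T → ℂ) (hf : IsTestFunctional T f) :
    -- the right-hand side is an absolutely convergent integral
    Integrable (fun c : ℝ => f (constL2 T c)) lineMeasure ∧
    -- the path integral has exactly one value, and it is the stated one
    (∀ I : ℂ, HasDeltaPathIntegral T β f I ↔
      I = ((|β| / √T : ℝ) : ℂ) * ∫ c : ℝ, f (constL2 T c) ∂lineMeasure) ∧
    -- the origin of the prefactor: factors of the modes, their zeta-regularized product,
    -- and the rescaling of the homogeneous mode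
    (∀ m : ℤ, m ≠ 0 → IsModeFactor T β m |T / (2 * Real.pi * m * β)|) ∧
    HasZetaProd (fun m : {m : ℤ // m ≠ 0} => |T / (2 * Real.pi * ((m : ℤ) : ℝ) * β)|) (|β| / T) ∧
    (((|β| / √T : ℝ) : ℂ) * ∫ c : ℝ, f (constL2 T c) ∂lineMeasure =
      ((|β| / T : ℝ) : ℂ) * ∫ c₀ : ℝ, f (toL2 T (c₀ • basis T 0)) ∂lineMeasure) := by
  have hT : 0 < T := Fact.out
  have hresc : ((|β| / √T : ℝ) : ℂ) * ∫ c : ℝ, f (constL2 T c) ∂lineMeasure =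
      ((|β| / T : ℝ) : ℂ) * ∫ c₀ : ℝ, f (toL2 T (c₀ • basis T 0)) ∂lineMeasure := by
    rw [integral_apply_smul_basis_zero, ← mul_assoc, ← Complex.ofReal_mul]
    congr 2
    nth_rw 2 [← Real.mul_self_sqrt hT.le]
    field_simp
  refine ⟨integrable_apply_constL2 hf, fun I => ?_, fun m hm => isModeFactor hβ hm,
    hasZetaProd_modeFactor hT hβ, hresc⟩
  rw [hasDeltaPathIntegral_iff hβ hf, hresc]
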